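/- Let $n, k \ge 0$ be integers and $\lambda\in\mathbb C$. Let $\Omega$ be $\mathbb R^n\setminus\{0\}$ or $\mathbb R^n$, and let $\mathcal D'(\Omega)$ be the space of complex-valued distributions on $\Omega$. For $a>0$ let $U_a$ be the dilation operator on $\mathcal D'(\Omega)$, $(U_af)(x)=f(ax)$, that is, $\langle U_af,\varphi\rangle=a^{-n}\langle f,\varphi(\cdot/a)\rangle$ for all test functions $\varphi$ on $\Omega$. A distribution $f$ is called homogeneous of degree $\mu\in\mathbb C$ if $U_af=a^{\mu}f$ for all $a>0$. Quasi associated homogeneous distributions (QAHD) of degree $\lambda$ and order $k$ are defined by recursion on $k$: $f\in\mathcal D'(\Omega)$ is a QAHD of degree $\lambda$ and order $k$ if there are distributions $f_{k-r}\in\mathcal D'(\Omega)$, $r=1,\dots,k$, not depending on $a$, such that each $f_{k-r}$ is a QAHD of degree $\lambda$ and order $k-r$ and $$U_af=a^{\lambda}f+\sum_{r=1}^{k}a^{\lambda}(\log a)^r f_{k-r}\qquad\text{for all } a>0$$ (for $k=0$ the sum is empty, so $f$ is homogeneous of degree $\lambda$). **Theorem.** For $f\in\mathcal D'(\mathbb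 R^n\setminus\{0\})$ the following statements are equivalent: (i) $f$ is a QAHD of degree $\lambda$ and order $k$; (ii) $(U_a-a^{\lambda}I)^{k+1}f=0$ for all $a>0$; (iii) $\bigl(\sum_{j=1}^n x_j\frac{\partial}{\partial x_j}-\lambda\bigr)^{k+1}f=0$; (iv) $f=r^{\lambda}\sum_{j=0}^{k}h_j\log^j r$ for some distributions $h_0,\dots,h_k\in\mathcal D'(\mathbb R^n\setminus\{0\})$ that are homogeneous of degree $0$, where $r=\|x\|$ is the Euclidean norm. Moreover, for $f\in\mathcal D'(\mathbb R^n)$ the statements (i), (ii) and (iii), read on $\mathbb R^n$, are equivalent. -/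

import Mathlib

open scoped Distributions ContDiff

noncomputable section

namespace QuasiHomogeneous

/-! ### Two operations on test functions: multiplication and dilation -/

section TestFunctions

open TopologicalSpace ContDiffMapSupportedIn

variable {n : ℕ}

/-- If `g` is smooth on the open set `Ω` and `φ` is smooth with support in `Ω`, then `g φ` is
smooth on the whole space. -/
theorem contDiff_mul_of_tsupport {Ω : Opens (EuclideanSpace ℝ (Fin n))}
    {g : EuclideanSpace ℝ (Fin n) → ℝ} (hg : ContDiffOn ℝ ∞ g Ω)
    {φ : EuclideanSpace ℝ (Fin n) → ℝ} (hφ : ContDiff ℝ ∞ φ)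
    (hs : tsupport φ ⊆ Ω) : ContDiff ℝ ∞ (fun x => g x * φ x) := by
  rw [contDiff_iff_contDiffAt]
  intro x
  by_cases hx : x ∈ Ω
  · exact (hg.contDiffAt (Ω.isOpen.mem_nhds hx)).mul hφ.contDiffAt
  · have h0 : φ =ᶠ[nhds x] 0 := notMem_tsupport_iff_eventuallyEq.1 fun h => hx (hs h)
    have h1 : (fun y => g y * φ y) =ᶠ[nhds x] fun _ => 0 := by
      filter_upwards [h0] with y hy
      simp [hy]
    exact contDiffAt_const.congr_of_eventuallyEq h1

/-- Multiplication by a real function `g`, smooth on `Ω`, of the smooth functions supported in a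
fixed compact subset `K` of `Ω`. -/
def mulSupportedIn {Ω : Opens (EuclideanSpace ℝ (Fin n))}
    (g : EuclideanSpace ℝ (Fin n) → ℝ) (hg : ContDiffOn ℝ ∞ g Ω)
    (K : Compacts (EuclideanSpace ℝ (Fin n)))
    (hK : (K : Set (EuclideanSpace ℝ (Fin n))) ⊆ Ω) :
    𝓓_{K}(EuclideanSpace ℝ (Fin n), ℝ) →L[ℝ] 𝓓_{K}(EuclideanSpace ℝ (Fin n), ℝ) :=
  ContDiffMapSupportedIn.mkCLM ℝ (fun φ x => g x * φ x)
    (fun φ ψ x => by simp [mul_add])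
    (fun c φ x => by simp [mul_left_comm])
    (fun φ => contDiff_mul_of_tsupport hg φ.contDiff (φ.tsupport_subset.trans hK))
    (fun φ x hx => by simp [φ.zero_on_compl hx])
    (fun k _ => by
      have hud : UniqueDiffOn ℝ (Ω : Set (EuclideanSpace ℝ (Fin n))) := Ω.isOpen.uniqueDiffOn
      have hb : ∀ i : ℕ, ∃ C : ℝ, ∀ x ∈ K,
          ‖iteratedFDerivWithin ℝ i g Ω x‖ ≤ C := fun i =>
        K.isCompact.exists_bound_of_continuousOn
          ((hg.continuousOn_iteratedFDerivWithin (mod_cast le_top) hud).mono hK)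
      choose C hC using hb
      refine ⟨Finset.Iic k, ∑ i ∈ Finset.range (k + 1), (k.choose i : ℝ) * |C i|,
        by positivity, fun φ x hx => ?_⟩
      have hxΩ : x ∈ (Ω : Set (EuclideanSpace ℝ (Fin n))) := hK hx
      rw [← iteratedFDerivWithin_of_isOpen k Ω.isOpen hxΩ, Finset.sum_mul]
      refine (norm_iteratedFDerivWithin_mul_le hg φ.contDiff.contDiffOn hud hxΩ
        (n := k) (mod_cast le_top)).trans (Finset.sum_le_sum fun i _ => ?_)
      have h1 : ‖iteratedFDerivWithin ℝ i g Ω x‖ ≤ |C i| := (hC i x hx).trans (le_abs_self _)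
      have h2 : ‖iteratedFDerivWithin ℝ (k - i) φ Ω x‖ ≤
          ((Finset.Iic k).sup fun j => N[ℝ]_{K, j}) φ := by
        rw [iteratedFDerivWithin_of_isOpen _ Ω.isOpen hxΩ]
        have h3 : N[ℝ; ℝ]_{K, k - i} ≤ (Finset.Iic k).sup fun j => N[ℝ; ℝ]_{K, j} :=
          Finset.le_sup (f := fun j => N[ℝ; ℝ]_{K, j}) (Finset.mem_Iic.2 (Nat.sub_le k i))
        exact (norm_iteratedFDeriv_apply_le_seminorm_top ℝ).trans (h3 φ)
      gcongr)

/-- Multiplication `φ ↦ g φ` of test functions on `Ω` by a real function `g` smooth on `Ω`. -/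
def mulTest {Ω : Opens (EuclideanSpace ℝ (Fin n))}
    (g : EuclideanSpace ℝ (Fin n) → ℝ) (hg : ContDiffOn ℝ ∞ g Ω) : 𝓓(Ω, ℝ) →L[ℝ] 𝓓(Ω, ℝ) :=
  TestFunction.limitCLM ℝ
    (fun φ => ⟨fun x => g x * φ x,
      contDiff_mul_of_tsupport hg φ.contDiff φ.tsupport_subset,
      φ.hasCompactSupport.mul_left,
      (tsupport_mul_subset_right (f := g) (g := φ)).trans φ.tsupport_subset⟩)
    (fun K hK => TestFunction.ofSupportedInCLM ℝ hK ∘L mulSupportedIn g hg K hK)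
    (fun _ _ _ => rfl)

@[simp]
theorem mulTest_apply {Ω : Opens (EuclideanSpace ℝ (Fin n))}
    (g : EuclideanSpace ℝ (Fin n) → ℝ) (hg : ContDiffOn ℝ ∞ g Ω) (φ : 𝓓(Ω, ℝ))
    (x : EuclideanSpace ℝ (Fin n)) : mulTest g hg φ x = g x * φ x := rfl

/-- An open subset of `ℝⁿ` that is invariant under all dilations `x ↦ a x`, `a > 0`. -/
class IsCone (Ω : Opens (EuclideanSpace ℝ (Fin n))) : Prop where
  smul_mem : ∀ a : ℝ, 0 < a → ∀ x ∈ Ω, a • x ∈ Ω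

/-- The dilate `a K` of a compact set. -/
def dilateCompacts (a : ℝ) (K : Compacts (EuclideanSpace ℝ (Fin n))) :
    Compacts (EuclideanSpace ℝ (Fin n)) :=
  K.map (fun x => a • x) (continuous_const_smul a)

theorem dilateCompacts_subset {Ω : Opens (EuclideanSpace ℝ (Fin n))} [IsCone Ω] {a : ℝ}
    (ha : 0 < a) {K : Compacts (EuclideanSpace ℝ (Fin n))}
    (hK : (K : Set (EuclideanSpace ℝ (Fin n))) ⊆ Ω) :
    (dilateCompacts a K : Set (EuclideanSpace ℝ (Fin n))) ⊆ Ω := by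
  rintro _ ⟨x, hx, rfl⟩
  exact IsCone.smul_mem a ha x (hK hx)

/-- The map `φ ↦ φ(· / a)` from the smooth functions supported in `K` to those supported
in `a K`. -/
def dilateSupportedIn (a : ℝ) (ha : 0 < a) (K : Compacts (EuclideanSpace ℝ (Fin n))) :
    𝓓_{K}(EuclideanSpace ℝ (Fin n), ℝ) →L[ℝ]
      𝓓_{dilateCompacts a K}(EuclideanSpace ℝ (Fin n), ℝ) :=
  ContDiffMapSupportedIn.mkCLM ℝ (fun φ x => φ (a⁻¹ • x))
    (fun φ ψ x => by simp)
    (fun c φ x => by simp)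
    (fun φ => φ.contDiff.comp (contDiff_const_smul a⁻¹))
    (fun φ x hx => φ.zero_on_compl fun h => hx ⟨a⁻¹ • x, h, by
      simp [smul_smul, mul_inv_cancel₀ ha.ne']⟩)
    (fun k _ => ⟨{k}, |a⁻¹| ^ k, by positivity, fun φ x _ => by
      rw [iteratedFDeriv_comp_const_smul a⁻¹ (φ.contDiff.of_le (mod_cast le_top)), norm_smul,
        norm_pow, Real.norm_eq_abs, Finset.sup_singleton]
      gcongr
      exact norm_iteratedFDeriv_apply_le_seminorm_top ℝ⟩)

/-- The map `φ ↦ φ(· / a)` on the test functions on a cone `Ω`, for `a > 0`. -/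
def dilateTest {Ω : Opens (EuclideanSpace ℝ (Fin n))} [IsCone Ω] (a : ℝ) (ha : 0 < a) :
    𝓓(Ω, ℝ) →L[ℝ] 𝓓(Ω, ℝ) :=
  TestFunction.limitCLM ℝ
    (fun φ =>
      letI K : Compacts (EuclideanSpace ℝ (Fin n)) := ⟨tsupport φ, φ.hasCompactSupport⟩
      TestFunction.ofSupportedIn (dilateCompacts_subset ha (K := K) φ.tsupport_subset)
        (dilateSupportedIn a ha K (.of_support_subset φ.contDiff subset_closure)))
    (fun K hK => TestFunction.ofSupportedInCLM ℝ (dilateCompacts_subset ha hK) ∘L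
      dilateSupportedIn a ha K)
    (fun _ _ _ => rfl)

@[simp]
theorem dilateTest_apply {Ω : Opens (EuclideanSpace ℝ (Fin n))} [IsCone Ω] (a : ℝ) (ha : 0 < a)
    (φ : 𝓓(Ω, ℝ)) (x : EuclideanSpace ℝ (Fin n)) : dilateTest a ha φ x = φ (a⁻¹ • x) := rfl

end TestFunctions

/-! ### Operators on complex-valued distributions

A complex-valued distribution on `Ω` is an element of Mathlib's `𝓓'(Ω, ℂ)`, a continuous
real-linear map from the real-valued test functions to `ℂ`; it extends uniquely to a continuous
complex-linear functional on the complex-valued test functions. -/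

section Distributions

open TopologicalSpace

variable {n : ℕ} {Ω : Opens (EuclideanSpace ℝ (Fin n))}

/-- The transpose of a continuous linear operator on test functions. -/
def transposeOp (A : 𝓓(Ω, ℝ) →L[ℝ] 𝓓(Ω, ℝ)) : Module.End ℂ 𝓓'(Ω, ℂ) where
  toFun f := A.precompCompactConvergenceCLM ℂ f
  map_add' _ _ := rfl
  map_smul' _ _ := rfl

/-- The dilation operator `U_a`, `(U_a f)(x) = f(a x)`, that is
`⟨U_a f, φ⟩ = a⁻ⁿ ⟨f, φ(· / a)⟩`. -/
def dilation [IsCone Ω] (a : ℝ) (ha : 0 < a) : Module.End ℂ 𝓓'(Ω, ℂ) :=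
  ((a : ℂ) ^ n)⁻¹ • transposeOp (dilateTest a ha)

theorem dilation_apply [IsCone Ω] (a : ℝ) (ha : 0 < a) (f : 𝓓'(Ω, ℂ)) (φ : 𝓓(Ω, ℝ)) :
    dilation a ha f φ = ((a : ℂ) ^ n)⁻¹ * f (dilateTest a ha φ) := rfl

/-- Multiplication of distributions on `Ω` by a complex function `g` smooth on `Ω`:
`⟨g f, φ⟩ = ⟨f, g φ⟩`, where `⟨f, g φ⟩` stands for `⟨f, (Re g) φ⟩ + i ⟨f, (Im g) φ⟩`. -/
def mulOp (g : EuclideanSpace ℝ (Fin n) → ℂ) (hg : ContDiffOn ℝ ∞ g Ω) :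
    Module.End ℂ 𝓓'(Ω, ℂ) :=
  transposeOp (mulTest (fun x => (g x).re) (Complex.reCLM.contDiff.comp_contDiffOn hg)) +
    Complex.I •
      transposeOp (mulTest (fun x => (g x).im) (Complex.imCLM.contDiff.comp_contDiffOn hg))

theorem mulOp_apply (g : EuclideanSpace ℝ (Fin n) → ℂ) (hg : ContDiffOn ℝ ∞ g Ω)
    (f : 𝓓'(Ω, ℂ)) (φ : 𝓓(Ω, ℝ)) :
    mulOp g hg f φ =
      f (mulTest (fun x => (g x).re) (Complex.reCLM.contDiff.comp_contDiffOn hg) φ) +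
        Complex.I *
          f (mulTest (fun x => (g x).im) (Complex.imCLM.contDiff.comp_contDiffOn hg) φ) := rfl

theorem contDiffOn_coord (j : Fin n) :
    ContDiffOn ℝ ∞ (fun x : EuclideanSpace ℝ (Fin n) => ((x j : ℝ) : ℂ)) Ω :=
  (Complex.ofRealCLM.contDiff.comp
    (EuclideanSpace.proj j : EuclideanSpace ℝ (Fin n) →L[ℝ] ℝ).contDiff).contDiffOn

/-- The partial derivative `∂ / ∂x_j` of distributions, `⟨∂_j f, φ⟩ = - ⟨f, ∂_j φ⟩`. -/
def partialOp (j : Fin n) : Module.End ℂ 𝓓'(Ω, ℂ) where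
  toFun f := Distribution.lineDerivCLM (EuclideanSpace.single j (1 : ℝ)) f
  map_add' f g := map_add _ f g
  map_smul' c f := by
    ext φ
    simp [Distribution.lineDerivCLM_apply]

/-- The Euler operator `∑ j, x_j ∂ / ∂x_j` on distributions. -/
def eulerOp : Module.End ℂ 𝓓'(Ω, ℂ) :=
  ∑ j : Fin n, mulOp (fun x => ((x j : ℝ) : ℂ)) (contDiffOn_coord j) * partialOp j

/-- `f` is homogeneous of degree `lam`: `f(a x) = a^lam f(x)` for all `a > 0`. -/
def IsHomogeneous [IsCone Ω] (lam : ℂ) (f : 𝓓'(Ω, ℂ)) : Prop :=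
  ∀ (a : ℝ) (ha : 0 < a), dilation a ha f = (a : ℂ) ^ lam • f

/-- `IsQAHD lam k f`: the distribution `f` is quasi associated homogeneous of degree `lam` and
order `k`. There are distributions `g (k - r)`, quasi associated homogeneous of degree `lam` and
order `k - r` (`r = 1, …, k`) and not depending on `a`, such that for all `a > 0`
`f(a x) = a^lam f(x) + ∑_{r=1}^k a^lam (log a)^r g (k - r)(x)`. The order drops from `k` to
`k - r`, so this is a recursion on `k`, and for `k = 0` the condition is homogeneity. -/
inductive IsQAHD [IsCone Ω] (lam : ℂ) : ℕ → 𝓓'(Ω, ℂ) → Prop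
  | intro (k : ℕ) (f : 𝓓'(Ω, ℂ)) (g : ℕ → 𝓓'(Ω, ℂ))
      (hg : ∀ r : ℕ, 1 ≤ r → r ≤ k → IsQAHD lam (k - r) (g (k - r)))
      (hf : ∀ (a : ℝ) (ha : 0 < a), dilation a ha f =
        (a : ℂ) ^ lam • f +
          ∑ r ∈ Finset.Icc 1 k, ((a : ℂ) ^ lam * ((Real.log a : ℝ) : ℂ) ^ r) • g (k - r)) :
      IsQAHD lam k f

end Distributions

/-! ### The whole space and the punctured space -/

section Punctured

open TopologicalSpace

/-- The punctured space `ℝⁿ \ {0}`. -/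
def punctured (n : ℕ) : Opens (EuclideanSpace ℝ (Fin n)) := ⟨{0}ᶜ, isOpen_compl_singleton⟩

instance isCone_top (n : ℕ) : IsCone (⊤ : Opens (EuclideanSpace ℝ (Fin n))) :=
  ⟨fun _ _ _ _ => trivial⟩

instance isCone_punctured (n : ℕ) : IsCone (punctured n) :=
  ⟨fun _ ha _ hx h => hx ((smul_eq_zero.1 h).resolve_left ha.ne')⟩

variable {n : ℕ}

theorem contDiffOn_norm_cpow (lam : ℂ) :
    ContDiffOn ℝ ∞ (fun x : EuclideanSpace ℝ (Fin n) => ((‖x‖ : ℝ) : ℂ) ^ lam)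
      (punctured n) := by
  have h : ContDiffOn ℝ ∞
      (fun x : EuclideanSpace ℝ (Fin n) => Complex.exp (((Real.log ‖x‖ : ℝ) : ℂ) * lam))
      (punctured n) := by
    intro x hx
    have hx0 : x ≠ 0 := hx
    have h1 : ContDiffAt ℝ ∞ (fun x : EuclideanSpace ℝ (Fin n) => Real.log ‖x‖) x :=
      (contDiffAt_norm ℝ hx0).log (norm_ne_zero_iff.2 hx0)
    exact (((Complex.ofRealCLM.contDiff.contDiffAt.comp x h1).mul
      contDiffAt_const).cexp).contDiffWithinAt
  refine h.congr fun x hx => ?_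
  have hx0 : ((‖x‖ : ℝ) : ℂ) ≠ 0 := by exact_mod_cast norm_ne_zero_iff.2 hx
  rw [Complex.cpow_def_of_ne_zero hx0, Complex.ofReal_log (norm_nonneg x)]

theorem contDiffOn_log_norm_pow (j : ℕ) :
    ContDiffOn ℝ ∞ (fun x : EuclideanSpace ℝ (Fin n) => ((Real.log ‖x‖ : ℝ) : ℂ) ^ j)
      (punctured n) := by
  intro x hx
  have hx0 : x ≠ 0 := hx
  have h1 : ContDiffAt ℝ ∞ (fun x : EuclideanSpace ℝ (Fin n) => Real.log ‖x‖) x :=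
    (contDiffAt_norm ℝ hx0).log (norm_ne_zero_iff.2 hx0)
  exact ((Complex.ofRealCLM.contDiff.contDiffAt.comp x h1).pow j).contDiffWithinAt

/-- Multiplication by `r^lam` on `𝓓'(ℝⁿ \ {0})`, where `r = ‖x‖` is the Euclidean norm. -/
def rPow (lam : ℂ) : Module.End ℂ 𝓓'(punctured n, ℂ) :=
  mulOp (fun x => ((‖x‖ : ℝ) : ℂ) ^ lam) (contDiffOn_norm_cpow lam)

/-- Multiplication by `(log r)^j` on `𝓓'(ℝⁿ \ {0})`, where `r = ‖x‖` is the Euclidean norm. -/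
def logPow (j : ℕ) : Module.End ℂ 𝓓'(punctured n, ℂ) :=
  mulOp (fun x => ((Real.log ‖x‖ : ℝ) : ℂ) ^ j) (contDiffOn_log_norm_pow j)

end Punctured

end QuasiHomogeneous

end

/-!
Why the equivalences hold. Write `U_a` for the dilations, `E` for the Euler operator, and
`G_t = exp (-lam t) U_{exp t}`, a one-parameter group of operators on distributions. The analytic
input is that `E - lam` generates `G_t` weakly: for a test function `φ`, the orbit
`t ↦ ⟨G_t f, φ⟩` has derivative `⟨G_t (E - lam) f, φ⟩` (`hasDerivAt_normalizedDilation`). It comes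
from the first order Taylor expansion of `φ (exp (-t) ·)`, which is uniform together with the
derivatives of every order (`exists_norm_iteratedFDeriv_dilate_sub_le`), and from the fact that a
distribution has finite order on a compact set (`exists_norm_le_of_tsupport_subset`).

On any dilation-invariant open set, three facts follow.
* If `(E - lam) ^ (k + 1) f = 0`, Taylor's formula is exact:
  `U_a f = a ^ lam ∑_{i ≤ k} (log a) ^ i / i! (E - lam) ^ i f`. By strong induction on `k`, this
  makes `f` quasi associated homogeneous, with `f_{k - r} = (E - lam) ^ r f / r!`.
* If `f` is quasi associated homogeneous of order `k`, then `U_a - a ^ lam` maps `f` to a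
  combination of distributions of lower order, so that its power `k + 1` annihilates `f`.
* If `(U_a - a ^ lam) ^ m f = 0` for all `a`, the `m`-th differences of the smooth function
  `t ↦ ⟨G_t f, φ⟩` vanish, hence so does its `m`-th derivative at `0`, which is
  `⟨(E - lam) ^ m f, φ⟩`.

On the punctured space, multiplication by `r ^ lam` is invertible and conjugates `E` to `E - lam`,
and `L`, the multiplication by `log r`, satisfies `E L = L E + 1`. Both relations are the
derivatives at `t = 0` of the evident relations for the dilations. By the second one the kernel of
`E ^ (k + 1)` is the set of sums `∑_{j ≤ k} L ^ j h_j` with `E h_j = 0`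
(`weyl_pow_apply_eq_zero_iff`), and `E h = 0` says that `h` is homogeneous of degree `0`.
-/

noncomputable section

namespace QuasiHomogeneous

/-! ### The radial derivative and dilations of smooth functions -/

section RadialDerivative

variable {E V : Type} [NormedAddCommGroup E] [NormedSpace ℝ E] [NormedAddCommGroup V]
  [NormedSpace ℝ V]

/-- The radial derivative `x ↦ φ'(x) x`, that is `∑ j, x_j ∂φ/∂x_j` in coordinates. -/
def radialDeriv (φ : E → V) (x : E) : V := fderiv ℝ φ x x

theorem contDiff_radialDeriv {φ : E → V} (hφ : ContDiff ℝ ∞ φ) :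
    ContDiff ℝ ∞ (radialDeriv φ) :=
  (hφ.fderiv_right (m := ∞) le_rfl).clm_apply contDiff_id

theorem tsupport_radialDeriv_subset (φ : E → V) : tsupport (radialDeriv φ) ⊆ tsupport φ := by
  refine (closure_mono fun x hx => ?_).trans (tsupport_fderiv_subset ℝ (f := φ))
  exact fun h => hx (by simp [radialDeriv, h])

/-- The case of one derivative in `iteratedFDeriv_radialDeriv`, by symmetry of the second
derivative. -/
theorem fderiv_radialDeriv {φ : E → V} (hφ : ContDiff ℝ ∞ φ) :
    fderiv ℝ (radialDeriv φ) = fderiv ℝ φ + radialDeriv (fderiv ℝ φ) := by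
  have h1 : Differentiable ℝ (fderiv ℝ φ) :=
    (hφ.fderiv_right (m := ∞) le_rfl).differentiable (by simp)
  ext x v
  have h2 : HasFDerivAt (radialDeriv φ) _ x := (h1 x).hasFDerivAt.clm_apply (hasFDerivAt_id x)
  have h3 : IsSymmSndFDerivAt ℝ φ x := hφ.contDiffAt.isSymmSndFDerivAt
    (by
    rw [minSmoothness_of_isRCLikeNormedField]
    exact WithTop.coe_le_coe.2 (le_top (a := (2 : ℕ∞))))
  rw [h2.fderiv]
  simp [radialDeriv, h3.eq v x]

/-- The commutation relation between iterated derivatives and the radial derivative: each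
derivative is homogeneous of degree `-1`, which accounts for the summand `i • iteratedFDeriv`. -/
theorem iteratedFDeriv_radialDeriv (i : ℕ) : ∀ {V : Type} [NormedAddCommGroup V]
    [NormedSpace ℝ V] {φ : E → V}, ContDiff ℝ ∞ φ → ∀ x,
    iteratedFDeriv ℝ i (radialDeriv φ) x =
      (i : ℝ) • iteratedFDeriv ℝ i φ x + radialDeriv (iteratedFDeriv ℝ i φ) x := by
  induction i with
  | zero =>
    intro V _ _ φ hφ x
    simp only [iteratedFDeriv_zero_eq_comp, Nat.cast_zero, zero_smul, zero_add, radialDeriv]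
    rw [LinearIsometryEquiv.comp_fderiv]
    rfl
  | succ i ih =>
    intro V _ _ φ hφ x
    have hd : ContDiff ℝ ∞ (fderiv ℝ φ) := hφ.fderiv_right (m := ∞) le_rfl
    have h : ∀ ψ : E → V, iteratedFDeriv ℝ (i + 1) ψ =
      (continuousMultilinearCurryRightEquiv' ℝ i E V).symm ∘ iteratedFDeriv ℝ i (fderiv ℝ ψ) :=
        fun ψ => funext fun _ => iteratedFDeriv_succ_eq_comp_right
    have h2 : radialDeriv (iteratedFDeriv ℝ (i + 1) φ) x =
        (continuousMultilinearCurryRightEquiv' ℝ i E V).symm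
          (radialDeriv (iteratedFDeriv ℝ i (fderiv ℝ φ)) x) := by
      rw [h, radialDeriv]
      exact congr($((continuousMultilinearCurryRightEquiv' ℝ i E V).symm.comp_fderiv
        (f := iteratedFDeriv ℝ i (fderiv ℝ φ)) (x := x)) x)
    rw [h2, h, h, Function.comp_apply, Function.comp_apply, fderiv_radialDeriv hφ,
      iteratedFDeriv_add_apply (hd.contDiffAt.of_le (mod_cast le_top))
        ((contDiff_radialDeriv hd).contDiffAt.of_le (mod_cast le_top)), ih hd,
      ← map_smul, ← map_add]
    congr 1
    push_cast
    module

/-- Along the flow `t ↦ exp (-t) x`, the derivatives of `φ (exp (-t) ·)` evolve by minus the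
radial derivative. -/
theorem hasDerivAt_iteratedFDeriv_dilate (i : ℕ) {φ : E → V} (hφ : ContDiff ℝ ∞ φ) (x : E)
    (t : ℝ) :
    HasDerivAt (fun s : ℝ => Real.exp (-s) ^ i • iteratedFDeriv ℝ i φ (Real.exp (-s) • x))
      (-(Real.exp (-t) ^ i • iteratedFDeriv ℝ i (radialDeriv φ) (Real.exp (-t) • x))) t := by
  have he : HasDerivAt (fun s : ℝ => Real.exp (-s)) (-Real.exp (-t)) t := by
    simpa using (hasDerivAt_neg t).exp
  have hF : Differentiable ℝ (iteratedFDeriv ℝ i φ) :=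
    hφ.differentiable_iteratedFDeriv (mod_cast WithTop.coe_lt_top i)
  have h1 := (hF (Real.exp (-t) • x)).hasFDerivAt.comp_hasDerivAt t (he.smul_const x)
  refine ((he.fun_pow i).smul h1).congr_deriv ?_
  rw [iteratedFDeriv_radialDeriv i hφ]
  rcases i with _ | i
  · simp [radialDeriv]
  · simp only [radialDeriv, neg_smul, map_neg, Nat.add_sub_cancel, Function.comp_apply]
    push_cast
    module

theorem exists_norm_iteratedFDeriv_le (i : ℕ) {φ : E → V} (hφ : ContDiff ℝ ∞ φ)
    (hs : HasCompactSupport φ) : ∃ C, 0 ≤ C ∧ ∀ x, ‖iteratedFDeriv ℝ i φ x‖ ≤ C := by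
  obtain ⟨C, hC⟩ := (hs.iteratedFDeriv (𝕜 := ℝ) i).exists_bound_of_continuous
    (hφ.continuous_iteratedFDeriv (mod_cast le_top))
  exact ⟨C, (norm_nonneg _).trans (hC 0), hC⟩

/-- The first order Taylor expansion of `t ↦ φ (exp (-t) ·)` at `t = 0`, uniformly on the space
and for the derivatives of every order. -/
theorem exists_norm_iteratedFDeriv_dilate_sub_le (i : ℕ) {φ : E → V} (hφ : ContDiff ℝ ∞ φ)
    (hs : HasCompactSupport φ) : ∃ C, 0 ≤ C ∧ ∀ t : ℝ, |t| ≤ 1 → ∀ x,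
      ‖iteratedFDeriv ℝ i
        (fun y => φ (Real.exp (-t) • y) - φ y + t • radialDeriv φ y) x‖ ≤ C * t ^ 2 := by
  have hψ := contDiff_radialDeriv hφ
  have hψs : HasCompactSupport (radialDeriv φ) :=
    hs.of_isClosed_subset (isClosed_tsupport _) (tsupport_radialDeriv_subset φ)
  obtain ⟨C, hC0, hC⟩ := exists_norm_iteratedFDeriv_le i (contDiff_radialDeriv hψ)
    (hψs.of_isClosed_subset (isClosed_tsupport _) (tsupport_radialDeriv_subset _))
  -- For `|t| ≤ 1` the factor `exp (-t) ^ i` is at most `exp 1 ^ i`.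
  refine ⟨Real.exp 1 ^ i * C, by positivity, fun t ht x => ?_⟩
  set u : (E → V) → ℝ → E [×i]→L[ℝ] V :=
    fun χ s => Real.exp (-s) ^ i • iteratedFDeriv ℝ i χ (Real.exp (-s) • x) with hu
  have hball : ∀ s ∈ Metric.closedBall (0 : ℝ) |t|, |s| ≤ |t| := fun s hs => by simpa using hs
  have h0 : (0 : ℝ) ∈ Metric.closedBall (0 : ℝ) |t| := by simp
  -- The derivative of `u φ` is `- u (radialDeriv φ)`, which moves at bounded speed.
  have h1 : ∀ s ∈ Metric.closedBall (0 : ℝ) |t|,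
      ‖u (radialDeriv φ) s - u (radialDeriv φ) 0‖ ≤ Real.exp 1 ^ i * C * |t| := by
    intro s hs
    have := (convex_closedBall (0 : ℝ) |t|).norm_image_sub_le_of_norm_hasDerivWithin_le
      (f := u (radialDeriv φ)) (C := Real.exp 1 ^ i * C)
      (fun r _ => (hasDerivAt_iteratedFDeriv_dilate i hψ x r).hasDerivWithinAt)
      (fun r hr => by
        rw [norm_neg, norm_smul, norm_pow, Real.norm_eq_abs, Real.abs_exp]
        have : -r ≤ 1 := (neg_le_abs r).trans ((hball r hr).trans ht)
        gcongr
        exact hC _) h0 hs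
    refine this.trans ?_
    rw [sub_zero, Real.norm_eq_abs]
    exact mul_le_mul_of_nonneg_left (hball s hs) (by positivity)
  have h2 := (convex_closedBall (0 : ℝ) |t|).norm_image_sub_le_of_norm_hasDerivWithin_le
      (f := fun s => u φ s + s • u (radialDeriv φ) 0) (C := Real.exp 1 ^ i * C * |t|)
      (fun r _ => ((hasDerivAt_iteratedFDeriv_dilate i hφ x r).add
        ((hasDerivAt_id r).smul_const (u (radialDeriv φ) 0))).hasDerivWithinAt)
      (fun r hr => by
        rw [one_smul, neg_add_eq_sub, norm_sub_rev]
        exact h1 r hr) h0 (by simp : t ∈ Metric.closedBall (0 : ℝ) |t|)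
  have h3 : iteratedFDeriv ℝ i (fun y => φ (Real.exp (-t) • y) - φ y + t • radialDeriv φ y) x =
      u φ t + t • u (radialDeriv φ) 0 - (u φ 0 + (0 : ℝ) • u (radialDeriv φ) 0) := by
    have c0 : ContDiff ℝ i φ := hφ.of_le (mod_cast le_top)
    have c1 : ContDiff ℝ i (fun y => φ (Real.exp (-t) • y)) :=
      c0.comp (contDiff_const_smul _)
    have c2 : ContDiff ℝ i (radialDeriv φ) := hψ.of_le (mod_cast le_top)
    have c3 : ContDiff ℝ i (fun y => t • radialDeriv φ y) := c2.const_smul t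
    rw [show (fun y => φ (Real.exp (-t) • y) - φ y + t • radialDeriv φ y) =
      ((fun y => φ (Real.exp (-t) • y)) - φ) + (t • radialDeriv φ) from rfl,
      iteratedFDeriv_add_apply (ContDiff.contDiffAt (by exact c1.sub c0))
        (ContDiff.contDiffAt (by exact c3)), iteratedFDeriv_sub_apply c1.contDiffAt c0.contDiffAt,
      iteratedFDeriv_const_smul_apply c2.contDiffAt,
      iteratedFDeriv_comp_const_smul _ c0]
    simp only [hu, neg_zero, Real.exp_zero, one_pow, one_smul]
    module
  rw [h3]
  refine h2.trans (le_of_eq ?_)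
  rw [sub_zero, Real.norm_eq_abs, mul_assoc, ← sq, sq_abs]

end RadialDerivative

/-! ### Finite order on compact sets -/

section Order

open TopologicalSpace

/-- A distribution has finite order on the test functions supported in a fixed compact set. -/
theorem exists_norm_le_of_tsupport_subset {n : ℕ} {Ω : Opens (EuclideanSpace ℝ (Fin n))}
    (f : 𝓓'(Ω, ℂ)) (K : Compacts (EuclideanSpace ℝ (Fin n)))
    (hK : (K : Set (EuclideanSpace ℝ (Fin n))) ⊆ Ω) :
    ∃ (s : Finset ℕ) (C : ℝ), 0 ≤ C ∧ ∀ (φ : 𝓓(Ω, ℝ)) (B : ℝ), 0 ≤ B → tsupport φ ⊆ K →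
      (∀ i ∈ s, ∀ x, ‖iteratedFDeriv ℝ i φ x‖ ≤ B) → ‖f φ‖ ≤ C * B := by
  let T : 𝓓_{K}(EuclideanSpace ℝ (Fin n), ℝ) →ₗ[ℝ] ℂ :=
    f.toLinearMap ∘ₗ (TestFunction.ofSupportedInCLM ℝ hK).toLinearMap
  have hT : Continuous ((normSeminorm ℝ ℂ).comp T) :=
    continuous_norm.comp (f.cont.comp (TestFunction.ofSupportedInCLM ℝ hK).continuous)
  obtain ⟨s, C, -, hC⟩ := Seminorm.bound_of_continuous
    (ContDiffMapSupportedIn.withSeminorms ℝ _ ℝ ⊤ K) _ hT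
  refine ⟨s, C, C.2, fun φ B hB hφ hb => ?_⟩
  let ψ : 𝓓_{K}(EuclideanSpace ℝ (Fin n), ℝ) :=
    .of_support_subset φ.contDiff (subset_closure.trans hφ)
  have h1 : ‖f φ‖ = ((normSeminorm ℝ ℂ).comp T) ψ := rfl
  rw [h1]
  refine (hC ψ).trans ?_
  rw [smul_apply, NNReal.smul_def, smul_eq_mul]
  refine mul_le_mul_of_nonneg_left (Seminorm.finset_sup_apply_le hB fun i hi => ?_) C.2
  exact (ContDiffMapSupportedIn.seminorm_top_le_iff ℝ hB i ψ).2 fun x _ => hb i hi x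

end Order

/-! ### The Euler operator as the generator of the dilations -/

section Generator

open TopologicalSpace

variable {n : ℕ} {Ω : Opens (EuclideanSpace ℝ (Fin n))}

/-- The radial derivative of a test function, as a test function. -/
def radialTest (φ : 𝓓(Ω, ℝ)) : 𝓓(Ω, ℝ) where
  toFun := radialDeriv φ
  contDiff' := contDiff_radialDeriv φ.contDiff
  hasCompactSupport' := φ.hasCompactSupport.of_isClosed_subset (isClosed_tsupport _)
    (tsupport_radialDeriv_subset φ)
  tsupport_subset' := (tsupport_radialDeriv_subset φ).trans φ.tsupport_subset

theorem radialTest_apply (φ : 𝓓(Ω, ℝ)) (x : EuclideanSpace ℝ (Fin n)) :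
    radialTest φ x = fderiv ℝ φ x x := rfl

/-- The evaluation of distributions at a fixed test function, as a complex-linear functional. -/
def pairing (φ : 𝓓(Ω, ℝ)) : 𝓓'(Ω, ℂ) →ₗ[ℂ] ℂ where
  toFun f := f φ
  map_add' _ _ := rfl
  map_smul' _ _ := rfl

theorem sum_smul_apply (s : Finset ℕ) (c : ℕ → ℂ) (g : ℕ → 𝓓'(Ω, ℂ)) (φ : 𝓓(Ω, ℝ)) :
    (∑ i ∈ s, c i • g i) φ = ∑ i ∈ s, c i * g i φ := by
  change pairing φ _ = _
  rw [map_sum]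
  rfl

theorem distribution_ext {f g : 𝓓'(Ω, ℂ)} (h : ∀ φ, f φ = g φ) : f = g := DFunLike.ext _ _ h

/-- The Euler operator is minus the transpose of `φ ↦ n φ + ∑ j, x_j ∂φ/∂x_j`. -/
theorem eulerOp_apply (f : 𝓓'(Ω, ℂ)) (φ : 𝓓(Ω, ℝ)) :
    eulerOp f φ = -(n * f φ) - f (radialTest φ) := by
  let T : Fin n → Module.End ℂ 𝓓'(Ω, ℂ) := fun j =>
    mulOp (fun x => ((x j : ℝ) : ℂ)) (contDiffOn_coord j) * partialOp j
  have h1 : ∀ j : Fin n, T j f φ =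
      -f (TestFunction.lineDerivCLM ℝ (EuclideanSpace.single j (1 : ℝ))
        (mulTest (fun x => x j) (EuclideanSpace.proj j : _ →L[ℝ] ℝ).contDiff.contDiffOn φ)) := by
    intro j
    -- The coordinates are real, so the imaginary part in `mulOp` vanishes.
    have h0 : mulTest (fun x : EuclideanSpace ℝ (Fin n) => (((x j : ℝ) : ℂ)).im)
        (Complex.imCLM.contDiff.comp_contDiffOn (contDiffOn_coord j)) φ = 0 := by
      ext x
      simp
    rw [Module.End.mul_apply, mulOp_apply, h0, map_zero, mul_zero, add_zero]
    rfl
  have h2 : ∑ j : Fin n, TestFunction.lineDerivCLM ℝ (EuclideanSpace.single j (1 : ℝ))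
        (mulTest (fun x => x j) (EuclideanSpace.proj j : _ →L[ℝ] ℝ).contDiff.contDiffOn φ) =
      (n : ℝ) • φ + radialTest φ := by
    ext x
    have h4 : ∀ j : Fin n, TestFunction.lineDerivCLM (k := ⊤) ℝ (EuclideanSpace.single j (1 : ℝ))
        (mulTest (fun x => x j) (EuclideanSpace.proj j : _ →L[ℝ] ℝ).contDiff.contDiffOn φ) x =
        φ x + fderiv ℝ φ x (x j • EuclideanSpace.single j 1) := by
      intro j
      have h5 : HasFDerivAt (fun y : EuclideanSpace ℝ (Fin n) => y j * φ y) _ x :=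
        (EuclideanSpace.proj j : EuclideanSpace ℝ (Fin n) →L[ℝ] ℝ).hasFDerivAt.mul
          (φ.contDiff.differentiable (by simp) x).hasFDerivAt
      rw [TestFunction.lineDerivCLM_apply_of_le (by simp)]
      refine (h5.hasLineDerivAt _).lineDeriv.trans ?_
      simp
      ring
    rw [sum_apply, Finset.sum_congr rfl fun j _ => h4 j, Finset.sum_add_distrib,
      ← map_sum (fderiv ℝ φ x)]
    have h6 : ∑ j, x j • EuclideanSpace.single j (1 : ℝ) = x := by
      simpa using (EuclideanSpace.basisFun (Fin n) ℝ).sum_repr x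
    rw [h6]
    simp [radialTest_apply]
  have h3 : eulerOp f φ = ∑ j : Fin n, T j f φ := by
    rw [show (eulerOp : Module.End ℂ 𝓓'(Ω, ℂ)) = ∑ j : Fin n, T j from rfl, LinearMap.sum_apply]
    exact map_sum (pairing φ) _ _
  rw [h3, Finset.sum_congr rfl fun j _ => h1 j, Finset.sum_neg_distrib, ← map_sum, h2, map_add,
    map_smul]
  simp
  ring

variable [IsCone Ω]

theorem dilation_mul (a b : ℝ) (ha : 0 < a) (hb : 0 < b) :
    (dilation a ha * dilation b hb : Module.End ℂ 𝓓'(Ω, ℂ)) =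
      dilation (a * b) (mul_pos ha hb) := by
  refine LinearMap.ext fun f => distribution_ext fun φ => ?_
  have : dilateTest b hb (dilateTest a ha φ) = dilateTest (a * b) (mul_pos ha hb) φ := by
    ext x
    simp [smul_smul, mul_comm]
  rw [Module.End.mul_apply, dilation_apply, dilation_apply, dilation_apply, this]
  push_cast
  rw [mul_pow, mul_inv, mul_assoc]

theorem dilation_one (f : 𝓓'(Ω, ℂ)) : dilation 1 one_pos f = f := by
  refine distribution_ext fun φ => ?_
  have : dilateTest 1 one_pos φ = φ := by
    ext x
    simp
  simp [dilation_apply, this]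

/-- The distributional pairing with `φ (exp (-t) ·)` is differentiable at `t = 0`: on the test
functions supported in the compact union of the dilates of the support of `φ`, the distribution
is controlled by finitely many derivatives, for which the Taylor expansion is uniform. -/
theorem hasDerivAt_dilateTest (f : 𝓓'(Ω, ℂ)) (φ : 𝓓(Ω, ℝ)) :
    HasDerivAt (fun t : ℝ => f (dilateTest (Real.exp t) (Real.exp_pos t) φ))
      (-f (radialTest φ)) 0 := by
  let K : Compacts (EuclideanSpace ℝ (Fin n)) :=
    ⟨(fun p : ℝ × EuclideanSpace ℝ (Fin n) => Real.exp p.1 • p.2) ''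
      (Set.Icc (-1) 1 ×ˢ tsupport φ),
      (isCompact_Icc.prod φ.hasCompactSupport.isCompact).image (by fun_prop)⟩
  have hKΩ : (K : Set (EuclideanSpace ℝ (Fin n))) ⊆ Ω := by
    rintro _ ⟨p, hp, rfl⟩
    exact IsCone.smul_mem _ (Real.exp_pos _) _ (φ.tsupport_subset hp.2)
  have hKmem : ∀ t : ℝ, |t| ≤ 1 → ∀ x, Real.exp (-t) • x ∈ tsupport φ → x ∈ K := by
    intro t ht x hx
    refine ⟨(t, Real.exp (-t) • x), ⟨abs_le.1 ht, hx⟩, ?_⟩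
    simp [smul_smul, ← Real.exp_add]
  obtain ⟨s, C, hC0, hC⟩ := exists_norm_le_of_tsupport_subset f K hKΩ
  choose D hD0 hD using fun i : ℕ =>
    exists_norm_iteratedFDeriv_dilate_sub_le i φ.contDiff φ.hasCompactSupport
  have hbound : ∀ t : ℝ, |t| ≤ 1 →
      ‖f (dilateTest (Real.exp t) (Real.exp_pos t) φ) - f φ + (t : ℂ) * f (radialTest φ)‖ ≤
        (C * ∑ i ∈ s, D i) * t ^ 2 := by
    intro t ht
    set δ : 𝓓(Ω, ℝ) := dilateTest (Real.exp t) (Real.exp_pos t) φ - φ + t • radialTest φ with hδ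
    have hδx : ⇑δ = fun y => φ (Real.exp (-t) • y) - φ y + t • radialDeriv φ y := by
      funext y
      simp [hδ, ← Real.exp_neg, radialTest_apply, radialDeriv]
    have hfδ : f δ = f (dilateTest (Real.exp t) (Real.exp_pos t) φ) - f φ +
        (t : ℂ) * f (radialTest φ) := by
      rw [hδ, map_add, map_sub, map_smul, Complex.real_smul]
    rw [← hfδ, mul_assoc]
    refine hC δ _ (mul_nonneg (Finset.sum_nonneg fun i _ => hD0 i) (sq_nonneg t)) ?_ ?_
    · refine closure_minimal (fun x hx => ?_) K.isCompact.isClosed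
      by_contra hxK
      have h1 : φ (Real.exp (-t) • x) = 0 :=
        image_eq_zero_of_notMem_tsupport fun h => hxK (hKmem t ht x h)
      have h2 : x ∉ tsupport φ := fun h => hxK (hKmem 0 (by simp) x (by simpa using h))
      have h3 : radialDeriv φ x = 0 :=
        image_eq_zero_of_notMem_tsupport fun h => h2 (tsupport_radialDeriv_subset _ h)
      refine hx ?_
      rw [hδx]
      simp [h1, h3, image_eq_zero_of_notMem_tsupport h2]
    · intro i hi x
      rw [hδx]
      refine (hD i t ht x).trans (mul_le_mul_of_nonneg_right ?_ (sq_nonneg t))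
      exact Finset.single_le_sum (fun j _ => hD0 j) hi
  have h0 : f (dilateTest (Real.exp 0) (Real.exp_pos 0) φ) = f φ := by
    congr 1
    ext x
    simp
  rw [hasDerivAt_iff_isLittleO]
  have hO : (fun t : ℝ => f (dilateTest (Real.exp t) (Real.exp_pos t) φ) -
      f (dilateTest (Real.exp 0) (Real.exp_pos 0) φ) - (t - 0) • -f (radialTest φ)) =O[nhds 0]
        fun t : ℝ => t ^ 2 := by
    refine Asymptotics.IsBigO.of_bound (C * ∑ i ∈ s, D i) ?_
    filter_upwards [Metric.closedBall_mem_nhds (0 : ℝ) one_pos] with t ht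
    have := hbound t (by simpa using ht)
    rw [h0, sub_zero, smul_neg, sub_neg_eq_add, Complex.real_smul]
    simpa using this
  refine hO.trans_isLittleO ?_
  simpa using Asymptotics.isLittleO_pow_id (𝕜 := ℝ) (n := 2) (by norm_num)

/-- The Euler operator is the infinitesimal generator of the one-parameter group
`t ↦ U_{exp t}`, in the weak sense. -/
theorem hasDerivAt_dilation (f : 𝓓'(Ω, ℂ)) (φ : 𝓓(Ω, ℝ)) (t : ℝ) :
    HasDerivAt (fun s : ℝ => dilation (Real.exp s) (Real.exp_pos s) f φ)
      (dilation (Real.exp t) (Real.exp_pos t) (eulerOp f) φ) t := by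
  -- The group law reduces the claim to `t = 0`.
  have key : ∀ ψ : 𝓓(Ω, ℝ), HasDerivAt
      (fun s : ℝ => dilation (Real.exp s) (Real.exp_pos s) f ψ) (eulerOp f ψ) 0 := by
    intro ψ
    have h1 : HasDerivAt (fun s : ℝ => (((Real.exp s : ℝ) : ℂ) ^ n)⁻¹) (-(n : ℂ)) 0 := by
      have : HasDerivAt (fun s : ℝ => (((Real.exp s : ℝ) ^ n)⁻¹ : ℝ)) (-(n : ℝ)) 0 := by
        refine (((Real.hasDerivAt_exp 0).fun_pow n).fun_inv (by simp)).congr_deriv ?_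
        simp
      exact (this.ofReal_comp.congr_deriv (by simp)).congr_of_eventuallyEq
        (Filter.Eventually.of_forall fun s => by simp)
    refine (h1.mul (hasDerivAt_dilateTest f ψ)).congr_deriv ?_
    have h0 : dilateTest (Real.exp 0) (Real.exp_pos 0) ψ = ψ := by
      ext x
      simp
    rw [eulerOp_apply, h0]
    simp
    ring
  have h2 : HasDerivAt (fun s : ℝ => s - t) 1 t := (hasDerivAt_id t).sub_const t
  have h3 := (key (dilateTest (Real.exp t) (Real.exp_pos t) φ))
  rw [← sub_self t] at h3
  have h4 := (HasDerivAt.scomp (h := fun s => s - t) t h3 h2).const_mul (((Real.exp t : ℝ) : ℂ) ^ n)⁻¹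
  refine (h4.congr_deriv (by rw [one_smul, dilation_apply])).congr_of_eventuallyEq
    (Filter.Eventually.of_forall fun s => ?_)
  have h5 := dilation_mul (Ω := Ω) (Real.exp t) (Real.exp (s - t)) (Real.exp_pos _)
    (Real.exp_pos _)
  have h6 : ∀ (b : ℝ) (hb : 0 < b), b = Real.exp s → dilation b hb f φ =
      dilation (Real.exp s) (Real.exp_pos s) f φ := by
    rintro _ _ rfl
    rfl
  refine (h6 _ (mul_pos (Real.exp_pos t) (Real.exp_pos (s - t)))
    (by rw [← Real.exp_add]; ring_nf)).symm.trans ?_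
  rw [← h5]
  rfl

end Generator

/-! ### The normalized one-parameter group -/

section NormalizedGroup

open TopologicalSpace

variable {n : ℕ} {Ω : Opens (EuclideanSpace ℝ (Fin n))} [IsCone Ω]

/-- The one-parameter group `a^(-lam) U_a`, with `a = exp t` and generator `eulerOp - lam`. -/
def normalizedDilation (lam : ℂ) (t : ℝ) : Module.End ℂ 𝓓'(Ω, ℂ) :=
  Complex.exp (-(lam * t)) • dilation (Real.exp t) (Real.exp_pos t)

theorem normalizedDilation_apply (lam : ℂ) (t : ℝ) (f : 𝓓'(Ω, ℂ)) (φ : 𝓓(Ω, ℝ)) :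
    normalizedDilation lam t f φ =
      Complex.exp (-(lam * t)) * dilation (Real.exp t) (Real.exp_pos t) f φ := rfl

theorem ofReal_exp_cpow (lam : ℂ) (t : ℝ) :
    ((Real.exp t : ℝ) : ℂ) ^ lam = Complex.exp (lam * t) := by
  rw [Complex.cpow_def_of_ne_zero (by exact_mod_cast (Real.exp_pos t).ne'), ← Complex.ofReal_log
    (Real.exp_pos t).le, Real.log_exp, mul_comm]

theorem normalizedDilation_sub_one (lam : ℂ) (t : ℝ) :
    (normalizedDilation lam t - 1 : Module.End ℂ 𝓓'(Ω, ℂ)) = Complex.exp (-(lam * t)) •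
      (dilation (Real.exp t) (Real.exp_pos t) - ((Real.exp t : ℝ) : ℂ) ^ lam • 1) := by
  rw [ofReal_exp_cpow, smul_sub, smul_smul, ← Complex.exp_add, neg_add_cancel, Complex.exp_zero,
    one_smul]
  rfl

/-- Rewriting the factor of a dilation, whose positivity proof depends on it. -/
theorem dilation_congr {a b : ℝ} (ha : 0 < a) (hb : 0 < b) (h : a = b) :
    (dilation a ha : Module.End ℂ 𝓓'(Ω, ℂ)) = dilation b hb := by
  subst h
  rfl

theorem normalizedDilation_zero (lam : ℂ) :
    (normalizedDilation lam 0 : Module.End ℂ 𝓓'(Ω, ℂ)) = 1 := by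
  refine LinearMap.ext fun f => ?_
  rw [normalizedDilation, dilation_congr (Real.exp_pos 0) one_pos Real.exp_zero]
  simp [dilation_one]

theorem normalizedDilation_add (lam : ℂ) (s t : ℝ) :
    (normalizedDilation lam (s + t) : Module.End ℂ 𝓓'(Ω, ℂ)) =
      normalizedDilation lam s * normalizedDilation lam t := by
  rw [normalizedDilation, normalizedDilation, normalizedDilation, smul_mul_smul_comm,
    dilation_mul, ← Complex.exp_add,
    dilation_congr (Real.exp_pos (s + t)) (mul_pos (Real.exp_pos s) (Real.exp_pos t))
      (Real.exp_add s t)]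
  congr 2
  push_cast
  ring

theorem normalizedDilation_pow (lam : ℂ) (t : ℝ) (j : ℕ) :
    (normalizedDilation lam t ^ j : Module.End ℂ 𝓓'(Ω, ℂ)) = normalizedDilation lam (j * t) := by
  induction j with
  | zero => simp [normalizedDilation_zero]
  | succ j ih => rw [pow_succ, ih, ← normalizedDilation_add]; congr 1; push_cast; ring

theorem hasDerivAt_normalizedDilation (lam : ℂ) (f : 𝓓'(Ω, ℂ)) (φ : 𝓓(Ω, ℝ)) (t : ℝ) :
    HasDerivAt (fun s : ℝ => normalizedDilation lam s f φ)
      (normalizedDilation lam t ((eulerOp - lam • 1 : Module.End ℂ 𝓓'(Ω, ℂ)) f) φ) t := by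
  have h1 : HasDerivAt (fun s : ℝ => Complex.exp (-(lam * s)))
      (Complex.exp (-(lam * t)) * (-lam)) t := by
    have h2 : HasDerivAt (fun s : ℝ => -(lam * (s : ℂ))) (-lam) t := by
      simpa using ((Complex.ofRealCLM.hasDerivAt (x := t)).const_mul lam).fun_neg
    exact h2.cexp
  refine (h1.mul (hasDerivAt_dilation f φ t)).congr_deriv ?_
  have h3 : dilation (Real.exp t) (Real.exp_pos t)
      ((eulerOp - lam • 1 : Module.End ℂ 𝓓'(Ω, ℂ)) f) φ =
      dilation (Real.exp t) (Real.exp_pos t) (eulerOp f) φ -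
        lam * dilation (Real.exp t) (Real.exp_pos t) f φ := by
    rw [LinearMap.sub_apply, map_sub, LinearMap.smul_apply, map_smul]
    rfl
  rw [normalizedDilation_apply, h3]
  ring

/-- Taylor's formula for the one-parameter group on a vector annihilated by a power of its
generator: the orbit is a polynomial in `t`. -/
theorem normalizedDilation_eq_sum_of_pow_eq_zero (lam : ℂ) (m : ℕ) :
    ∀ f : 𝓓'(Ω, ℂ), ((eulerOp - lam • 1 : Module.End ℂ 𝓓'(Ω, ℂ)) ^ m) f = 0 →
      ∀ (φ : 𝓓(Ω, ℝ)) (t : ℝ), normalizedDilation lam t f φ =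
        ∑ i ∈ Finset.range m, ((t : ℂ) ^ i / (i.factorial : ℂ)) *
          ((eulerOp - lam • 1 : Module.End ℂ 𝓓'(Ω, ℂ)) ^ i) f φ := by
  set N : Module.End ℂ 𝓓'(Ω, ℂ) := eulerOp - lam • 1 with hN
  induction m with
  | zero =>
    intro f hf φ t
    rw [pow_zero, Module.End.one_apply] at hf
    subst hf
    rw [map_zero]
    simp
  | succ m ih =>
    intro f hf φ t
    have hNf := ih (N f) (by rwa [← Module.End.mul_apply, ← pow_succ]) φ
    -- The difference of the two sides has derivative zero, by the formula for `N f`.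
    have hd : ∀ t : ℝ, HasDerivAt (fun s : ℝ => normalizedDilation lam s f φ -
        ∑ i ∈ Finset.range (m + 1), ((s : ℂ) ^ i / (i.factorial : ℂ)) * (N ^ i) f φ) 0 t := by
      intro t
      have h1 : ∀ i ∈ Finset.range (m + 1), HasDerivAt
          (fun s : ℝ => ((s : ℂ) ^ i / (i.factorial : ℂ)) * (N ^ i) f φ)
          (((i : ℂ) * (t : ℂ) ^ (i - 1) / (i.factorial : ℂ)) * (N ^ i) f φ) t := by
        intro i _
        have h2 := ((Complex.ofRealCLM.hasDerivAt (x := t)).fun_pow i).div_const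
          (i.factorial : ℂ)
        simpa using h2.mul_const ((N ^ i) f φ)
      refine ((hasDerivAt_normalizedDilation lam f φ t).sub
        (HasDerivAt.fun_sum h1)).congr_deriv ?_
      rw [← hN, hNf t, Finset.sum_range_succ']
      simp only [Nat.cast_zero, zero_mul, zero_div, add_zero, sub_eq_zero]
      refine Finset.sum_congr rfl fun i _ => ?_
      rw [pow_succ N i, Module.End.mul_apply, Nat.add_sub_cancel, Nat.factorial_succ]
      have : ((i : ℂ) + 1) ≠ 0 := by exact_mod_cast i.succ_ne_zero
      have : (i.factorial : ℂ) ≠ 0 := by exact_mod_cast i.factorial_ne_zero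
      push_cast
      field_simp
    have hc := is_const_of_deriv_eq_zero (fun t => (hd t).differentiableAt)
      (fun t => (hd t).deriv) t 0
    rw [sub_eq_iff_eq_add] at hc
    rw [hc, Finset.sum_range_succ', normalizedDilation_zero]
    simp

theorem dilation_eq_sum_of_pow_eq_zero (lam : ℂ) (m : ℕ) (f : 𝓓'(Ω, ℂ))
    (hf : ((eulerOp - lam • 1 : Module.End ℂ 𝓓'(Ω, ℂ)) ^ m) f = 0) (a : ℝ) (ha : 0 < a) :
    dilation a ha f = ∑ i ∈ Finset.range m,
      ((a : ℂ) ^ lam * ((Real.log a : ℝ) : ℂ) ^ i) • ((i.factorial : ℂ)⁻¹ •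
        ((eulerOp - lam • 1 : Module.End ℂ 𝓓'(Ω, ℂ)) ^ i) f) := by
  obtain ⟨t, rfl⟩ : ∃ t, a = Real.exp t := ⟨Real.log a, (Real.exp_log ha).symm⟩
  refine distribution_ext fun φ => ?_
  have h := normalizedDilation_eq_sum_of_pow_eq_zero lam m f hf φ t
  rw [normalizedDilation_apply] at h
  have h1 : dilation (Real.exp t) ha f φ = Complex.exp (lam * t) *
      (Complex.exp (-(lam * t)) * dilation (Real.exp t) (Real.exp_pos t) f φ) := by
    rw [← mul_assoc, ← Complex.exp_add, add_neg_cancel, Complex.exp_zero, one_mul]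
  rw [h1, h, ofReal_exp_cpow, Real.log_exp, Finset.mul_sum]
  rw [sum_smul_apply]
  refine Finset.sum_congr rfl fun i _ => ?_
  change _ = Complex.exp (lam * t) * (t : ℂ) ^ i * ((i.factorial : ℂ)⁻¹ *
    ((eulerOp - lam • 1 : Module.End ℂ 𝓓'(Ω, ℂ)) ^ i) f φ)
  rw [div_eq_mul_inv]
  ring

/-- The summand `g (k - r)` in the recursive definition is `(eulerOp - lam) ^ r f / r!`, read off
from the exact Taylor formula; it is annihilated by a lower power of `eulerOp - lam`. -/
theorem isQAHD_of_pow_eulerOp_eq_zero (lam : ℂ) (k : ℕ) :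
    ∀ f : 𝓓'(Ω, ℂ), ((eulerOp - lam • 1 : Module.End ℂ 𝓓'(Ω, ℂ)) ^ (k + 1)) f = 0 →
      IsQAHD lam k f := by
  induction k using Nat.strong_induction_on with
  | _ k ih =>
    intro f hf
    set N : Module.End ℂ 𝓓'(Ω, ℂ) := eulerOp - lam • 1 with hN
    refine .intro k f (fun j => (((k - j).factorial : ℂ)⁻¹ • (N ^ (k - j)) f)) ?_ ?_
    · intro r h1 hr
      refine ih (k - r) (by omega) _ ?_
      rw [map_smul, ← Module.End.mul_apply, ← pow_add,
        show k - r + 1 + (k - (k - r)) = k + 1 by omega, hf]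
      exact smul_zero (M := ℂ) (A := 𝓓'(Ω, ℂ)) _
    · intro a ha
      rw [dilation_eq_sum_of_pow_eq_zero lam (k + 1) f hf a ha, Finset.range_eq_Ico,
        Finset.sum_eq_sum_Ico_succ_bot k.succ_pos, ← hN]
      congr 1
      · simp
      · refine Finset.sum_congr rfl fun r hr => ?_
        rw [Nat.sub_sub_self (by have := Finset.mem_Ico.1 hr; omega)]

theorem pow_dilation_sub_eq_zero_of_isQAHD (lam : ℂ) (k : ℕ) (f : 𝓓'(Ω, ℂ))
    (h : IsQAHD lam k f) (a : ℝ) (ha : 0 < a) :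
    ((dilation a ha - (a : ℂ) ^ lam • 1 : Module.End ℂ 𝓓'(Ω, ℂ)) ^ (k + 1)) f = 0 := by
  induction h with
  | intro k f g hg hf ih =>
    have h1 : (dilation a ha - (a : ℂ) ^ lam • 1 : Module.End ℂ 𝓓'(Ω, ℂ)) f =
        ∑ r ∈ Finset.Icc 1 k, ((a : ℂ) ^ lam * ((Real.log a : ℝ) : ℂ) ^ r) • g (k - r) := by
      rw [LinearMap.sub_apply, hf a ha]
      simp
    rw [pow_succ, Module.End.mul_apply, h1, map_sum]
    refine Finset.sum_eq_zero fun r hr => ?_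
    obtain ⟨hr1, hrk⟩ := Finset.mem_Icc.1 hr
    rw [map_smul, show k = (r - 1) + (k - r + 1) by omega, pow_add, Module.End.mul_apply,
      show r - 1 + (k - r + 1) - r = k - r by omega, ih r hr1 hrk, map_zero]
    exact smul_zero (M := ℂ) (A := 𝓓'(Ω, ℂ)) _

theorem iteratedDeriv_normalizedDilation (lam : ℂ) (f : 𝓓'(Ω, ℂ)) (φ : 𝓓(Ω, ℝ)) (i : ℕ) :
    iteratedDeriv i (fun s : ℝ => normalizedDilation lam s f φ) =
      fun s => normalizedDilation lam s
        (((eulerOp - lam • 1 : Module.End ℂ 𝓓'(Ω, ℂ)) ^ i) f) φ := by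
  induction i with
  | zero => simp
  | succ i ih =>
    rw [iteratedDeriv_succ, ih]
    funext s
    rw [(hasDerivAt_normalizedDilation lam _ φ s).deriv, pow_succ', Module.End.mul_apply]

theorem contDiff_normalizedDilation (lam : ℂ) (f : 𝓓'(Ω, ℂ)) (φ : 𝓓(Ω, ℝ)) :
    ContDiff ℝ ∞ (fun s : ℝ => normalizedDilation lam s f φ) := by
  refine contDiff_of_differentiable_iteratedDeriv fun i _ => ?_
  rw [iteratedDeriv_normalizedDilation]
  exact fun s => (hasDerivAt_normalizedDilation lam _ φ s).differentiableAt

/-- If all `m`-th differences with base point `0` of a smooth function vanish, then so does its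
`m`-th derivative at `0`: the `m`-th derivative in the step `h`, at `h = 0`, of the difference is
`m!` times the derivative of the function. -/
theorem iteratedDeriv_eq_zero_of_fwdDiff_eq_zero {p : ℝ → ℂ} (hp : ContDiff ℝ ∞ p) (m : ℕ)
    (h : ∀ t : ℝ, ∑ j ∈ Finset.range (m + 1),
      (((-1 : ℤ) ^ (m - j) * m.choose j : ℤ) : ℂ) * p (j * t) = 0) :
    iteratedDeriv m p 0 = 0 := by
  have hm : ContDiff ℝ m p := hp.of_le (mod_cast le_top)
  have h1 : iteratedDeriv m (fun t : ℝ => ∑ j ∈ Finset.range (m + 1),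
      (((-1 : ℤ) ^ (m - j) * m.choose j : ℤ) : ℂ) * p (j * t)) 0 =
      (m.factorial : ℂ) * iteratedDeriv m p 0 := by
    have h0 : ∀ j ∈ Finset.range (m + 1), ContDiffAt ℝ m (fun t : ℝ =>
        (((-1 : ℤ) ^ (m - j) * m.choose j : ℤ) : ℂ) * p (j * t)) 0 := fun j _ =>
      (contDiff_const.mul (hm.comp (contDiff_const.mul contDiff_id))).contDiffAt
    rw [iteratedDeriv_fun_sum h0]
    -- This is the `m`-th difference of `x ↦ x ^ m` at `0`.
    have h2 : (∑ j ∈ Finset.range (m + 1),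
        (((-1 : ℤ) ^ (m - j) * m.choose j : ℤ) : ℂ) * (j : ℂ) ^ m) = (m.factorial : ℂ) := by
      have h3 := congrFun (fwdDiff_iter_eq_factorial (R := ℂ) (n := m)) 0
      rw [fwdDiff_iter_eq_sum_shift] at h3
      simpa using h3
    rw [← h2, Finset.sum_mul]
    refine Finset.sum_congr rfl fun j _ => ?_
    rw [iteratedDeriv_const_mul_field, iteratedDeriv_comp_const_smul hm]
    simp [mul_assoc]
  have h4 : (m.factorial : ℂ) * iteratedDeriv m p 0 = 0 := by
    rw [← h1, funext h]
    simp
  exact (mul_eq_zero.1 h4).resolve_left (by exact_mod_cast m.factorial_ne_zero)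

/-- The binomial expansion of `(normalizedDilation lam t - 1) ^ m`, paired with a test function, is
an `m`-th difference of the smooth orbit `t ↦ normalizedDilation lam t f φ`. -/
theorem pow_eulerOp_eq_zero_of_pow_dilation_sub_eq_zero (lam : ℂ) (m : ℕ) (f : 𝓓'(Ω, ℂ))
    (h : ∀ (a : ℝ) (ha : 0 < a),
      ((dilation a ha - (a : ℂ) ^ lam • 1 : Module.End ℂ 𝓓'(Ω, ℂ)) ^ m) f = 0) :
    ((eulerOp - lam • 1 : Module.End ℂ 𝓓'(Ω, ℂ)) ^ m) f = 0 := by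
  refine distribution_ext fun φ => ?_
  have h1 := iteratedDeriv_eq_zero_of_fwdDiff_eq_zero (contDiff_normalizedDilation lam f φ) m ?_
  · rw [iteratedDeriv_normalizedDilation] at h1
    simpa [normalizedDilation_zero] using h1
  · intro t
    have h2 : ((normalizedDilation lam t - 1 : Module.End ℂ 𝓓'(Ω, ℂ)) ^ m) f = 0 := by
      rw [normalizedDilation_sub_one, smul_pow, LinearMap.smul_apply, h, smul_zero]
    have h3 : (normalizedDilation lam t - 1 : Module.End ℂ 𝓓'(Ω, ℂ)) ^ m =
        ∑ j ∈ Finset.range (m + 1), (((-1 : ℤ) ^ (m - j) * m.choose j : ℤ) : ℂ) •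
          (normalizedDilation lam (j * t) : Module.End ℂ 𝓓'(Ω, ℂ)) := by
      rw [sub_eq_add_neg, (Commute.neg_one_right _).add_pow]
      refine Finset.sum_congr rfl fun j _ => ?_
      have hc : ((-1) ^ (m - j) * (m.choose j : Module.End ℂ 𝓓'(Ω, ℂ))) =
          algebraMap ℂ _ (((-1 : ℤ) ^ (m - j) * m.choose j : ℤ) : ℂ) := by simp
      rw [normalizedDilation_pow, mul_assoc, hc, ← Algebra.commutes, Algebra.smul_def]
    rw [h3, LinearMap.sum_apply] at h2
    simp only [LinearMap.smul_apply] at h2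
    rw [← sum_smul_apply, h2]
    rfl

end NormalizedGroup

/-! ### Operators with `D L = L D + 1` -/

section Weyl

variable {M : Type*} [AddCommGroup M] [Module ℂ M] {D L : Module.End ℂ M}

theorem weyl_mul_pow (h : D * L = L * D + 1) (j : ℕ) :
    D * L ^ (j + 1) = L ^ (j + 1) * D + ((j : ℂ) + 1) • L ^ j := by
  induction j with
  | zero => simp [h]
  | succ j ih =>
    rw [pow_succ, ← mul_assoc, ih, add_mul, mul_assoc, h, mul_add, mul_one, ← mul_assoc,
      smul_mul_assoc, ← pow_succ, ← pow_succ]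
    push_cast
    module

theorem weyl_pow_mul_pow_apply (h : D * L = L * D + 1) {v : M} (hv : D v = 0) (j : ℕ) :
    (D ^ j) ((L ^ j) v) = (j.factorial : ℂ) • v := by
  induction j with
  | zero => simp
  | succ j ih =>
    have h1 : D ((L ^ (j + 1)) v) = ((j : ℂ) + 1) • (L ^ j) v := by
      have := LinearMap.congr_fun (weyl_mul_pow h j) v
      simpa [hv] using this
    rw [pow_succ, Module.End.mul_apply, h1, map_smul, ih, smul_smul, Nat.factorial_succ]
    push_cast
    rfl

/-- If `D L = L D + 1`, so that `D` acts as a derivative and `L` as multiplication by the variable,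
then the kernel of `D ^ m` consists of the polynomials in `L` of degree less than `m`, with
coefficients in the kernel of `D`. -/
theorem weyl_pow_apply_eq_zero_iff (h : D * L = L * D + 1) (m : ℕ) (u : M) :
    (D ^ m) u = 0 ↔
      ∃ c : ℕ → M, (∀ j < m, D (c j) = 0) ∧ u = ∑ j ∈ Finset.range m, (L ^ j) (c j) := by
  constructor
  · induction m generalizing u with
    | zero => exact fun hu => ⟨0, by simp, by simpa using hu⟩
    | succ m ih =>
      intro hu
      -- The leading coefficient is `D ^ m u / m!`.
      set v : M := (m.factorial : ℂ)⁻¹ • (D ^ m) u with hv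
      have hDv : D v = 0 := by
        rw [hv, map_smul, ← Module.End.mul_apply, ← pow_succ', hu, smul_zero]
      have hm : (m.factorial : ℂ) ≠ 0 := by exact_mod_cast m.factorial_ne_zero
      obtain ⟨c, hc, hcu⟩ := ih (u - (L ^ m) v) (by
        rw [map_sub, weyl_pow_mul_pow_apply h hDv, hv, smul_smul, mul_inv_cancel₀ hm, one_smul,
          sub_self])
      refine ⟨Function.update c m v, fun j hj => ?_, ?_⟩
      · rcases (Nat.lt_succ_iff_lt_or_eq.1 hj) with hj | rfl
        · rw [Function.update_of_ne hj.ne]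
          exact hc j hj
        · rwa [Function.update_self]
      · rw [Finset.sum_range_succ, Function.update_self, eq_add_of_sub_eq hcu]
        congr 1
        refine Finset.sum_congr rfl fun j hj => ?_
        rw [Function.update_of_ne (Finset.mem_range.1 hj).ne]
  · rintro ⟨c, hc, rfl⟩
    rw [map_sum]
    refine Finset.sum_eq_zero fun j hj => ?_
    have hj := Finset.mem_range.1 hj
    rw [show m = (m - (j + 1)) + 1 + j by omega, pow_add, Module.End.mul_apply,
      weyl_pow_mul_pow_apply h (hc j hj), map_smul, pow_succ, Module.End.mul_apply, hc j hj,
      map_zero, smul_zero]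

end Weyl

/-! ### Multiplication operators and dilations -/

section Multiplication

open TopologicalSpace

variable {n : ℕ} {Ω : Opens (EuclideanSpace ℝ (Fin n))}

/-- The test function `(Re g) φ`. -/
def reTest {g : EuclideanSpace ℝ (Fin n) → ℂ} (hg : ContDiffOn ℝ ∞ g Ω) (φ : 𝓓(Ω, ℝ)) : 𝓓(Ω, ℝ) :=
  mulTest (fun x => (g x).re) (Complex.reCLM.contDiff.comp_contDiffOn hg) φ

/-- The test function `(Im g) φ`. -/
def imTest {g : EuclideanSpace ℝ (Fin n) → ℂ} (hg : ContDiffOn ℝ ∞ g Ω) (φ : 𝓓(Ω, ℝ)) : 𝓓(Ω, ℝ) :=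
  mulTest (fun x => (g x).im) (Complex.imCLM.contDiff.comp_contDiffOn hg) φ

@[simp]
theorem reTest_apply {g : EuclideanSpace ℝ (Fin n) → ℂ} (hg : ContDiffOn ℝ ∞ g Ω) (φ : 𝓓(Ω, ℝ))
    (x : EuclideanSpace ℝ (Fin n)) : reTest hg φ x = (g x).re * φ x := rfl

@[simp]
theorem imTest_apply {g : EuclideanSpace ℝ (Fin n) → ℂ} (hg : ContDiffOn ℝ ∞ g Ω) (φ : 𝓓(Ω, ℝ))
    (x : EuclideanSpace ℝ (Fin n)) : imTest hg φ x = (g x).im * φ x := rfl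

theorem mulOp_apply_eq {g : EuclideanSpace ℝ (Fin n) → ℂ} (hg : ContDiffOn ℝ ∞ g Ω)
    (f : 𝓓'(Ω, ℂ)) (φ : 𝓓(Ω, ℝ)) :
    mulOp g hg f φ = f (reTest hg φ) + Complex.I * f (imTest hg φ) := rfl

theorem mulOp_congr {g g' : EuclideanSpace ℝ (Fin n) → ℂ} (hg : ContDiffOn ℝ ∞ g Ω)
    (hg' : ContDiffOn ℝ ∞ g' Ω) (h : ∀ x ∈ Ω, g x = g' x) : mulOp g hg = mulOp g' hg' := by
  refine LinearMap.ext fun f => distribution_ext fun φ => ?_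
  have h0 : ∀ x, g x = g' x ∨ φ x = 0 := fun x => by
    by_cases hx : x ∈ Ω
    · exact .inl (h x hx)
    · exact .inr (image_eq_zero_of_notMem_tsupport fun h => hx (φ.tsupport_subset h))
  have h1 : reTest hg φ = reTest hg' φ := by
    ext x
    rcases h0 x with h | h <;> simp [h]
  have h2 : imTest hg φ = imTest hg' φ := by
    ext x
    rcases h0 x with h | h <;> simp [h]
  rw [mulOp_apply_eq, mulOp_apply_eq, h1, h2]

theorem mulOp_const (c : ℂ) (h : ContDiffOn ℝ ∞ (fun _ : EuclideanSpace ℝ (Fin n) => c) Ω) :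
    mulOp (fun _ => c) h = (c • 1 : Module.End ℂ 𝓓'(Ω, ℂ)) := by
  refine LinearMap.ext fun f => distribution_ext fun φ => ?_
  have h1 : reTest h φ = c.re • φ := by
    ext x
    simp
  have h2 : imTest h φ = c.im • φ := by
    ext x
    simp
  rw [mulOp_apply_eq, h1, h2, map_smul, map_smul, Complex.real_smul, Complex.real_smul]
  change _ = c * f φ
  nth_rewrite 3 [← Complex.re_add_im c]
  ring

theorem mulOp_add {g g' : EuclideanSpace ℝ (Fin n) → ℂ} (hg : ContDiffOn ℝ ∞ g Ω)
    (hg' : ContDiffOn ℝ ∞ g' Ω) :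
    mulOp (fun x => g x + g' x) (hg.add hg') = mulOp g hg + mulOp g' hg' := by
  refine LinearMap.ext fun f => distribution_ext fun φ => ?_
  change _ = mulOp g hg f φ + mulOp g' hg' f φ
  have h1 : reTest (hg.add hg') φ = reTest hg φ + reTest hg' φ := by
    ext x
    simp [add_mul]
  have h2 : imTest (hg.add hg') φ = imTest hg φ + imTest hg' φ := by
    ext x
    simp [add_mul]
  rw [mulOp_apply_eq, mulOp_apply_eq, mulOp_apply_eq, h1, h2, map_add, map_add]
  ring

theorem mulOp_mul {g g' : EuclideanSpace ℝ (Fin n) → ℂ} (hg : ContDiffOn ℝ ∞ g Ω)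
    (hg' : ContDiffOn ℝ ∞ g' Ω) :
    mulOp g hg * mulOp g' hg' = mulOp (fun x => g x * g' x) (hg.mul hg') := by
  refine LinearMap.ext fun f => distribution_ext fun φ => ?_
  have h1 : reTest (hg.mul hg') φ = reTest hg' (reTest hg φ) - imTest hg' (imTest hg φ) := by
    ext x
    simp
    ring
  have h2 : imTest (hg.mul hg') φ = imTest hg' (reTest hg φ) + reTest hg' (imTest hg φ) := by
    ext x
    simp
    ring
  rw [Module.End.mul_apply, mulOp_apply_eq, mulOp_apply_eq, mulOp_apply_eq, mulOp_apply_eq, h1, h2,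
    map_sub, map_add]
  linear_combination f (imTest hg' (imTest hg φ)) * Complex.I_sq

variable [IsCone Ω]

theorem contDiffOn_comp_smul {g : EuclideanSpace ℝ (Fin n) → ℂ} (hg : ContDiffOn ℝ ∞ g Ω)
    {a : ℝ} (ha : 0 < a) : ContDiffOn ℝ ∞ (fun x => g (a • x)) Ω :=
  hg.comp (contDiff_const_smul a).contDiffOn fun x hx => IsCone.smul_mem a ha x hx

theorem dilation_mul_mulOp {g : EuclideanSpace ℝ (Fin n) → ℂ} (hg : ContDiffOn ℝ ∞ g Ω)
    (a : ℝ) (ha : 0 < a) :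
    dilation a ha * mulOp g hg =
      mulOp (fun x => g (a • x)) (contDiffOn_comp_smul hg ha) * dilation a ha := by
  refine LinearMap.ext fun f => distribution_ext fun φ => ?_
  have h1 : reTest hg (dilateTest a ha φ) =
      dilateTest a ha (reTest (contDiffOn_comp_smul hg ha) φ) := by
    ext x
    simp [smul_smul, mul_inv_cancel₀ ha.ne']
  have h2 : imTest hg (dilateTest a ha φ) =
      dilateTest a ha (imTest (contDiffOn_comp_smul hg ha) φ) := by
    ext x
    simp [smul_smul, mul_inv_cancel₀ ha.ne']
  rw [Module.End.mul_apply, Module.End.mul_apply, dilation_apply, mulOp_apply_eq, mulOp_apply_eq,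
    dilation_apply, dilation_apply, h1, h2]
  ring

theorem hasDerivAt_mulOp_normalizedDilation {g : EuclideanSpace ℝ (Fin n) → ℂ}
    (hg : ContDiffOn ℝ ∞ g Ω) (f : 𝓓'(Ω, ℂ)) (φ : 𝓓(Ω, ℝ)) :
    HasDerivAt (fun t : ℝ => mulOp g hg (normalizedDilation 0 t f) φ)
      (mulOp g hg (eulerOp f) φ) 0 := by
  have h := fun ψ => hasDerivAt_normalizedDilation 0 f ψ 0
  simp only [normalizedDilation_zero, zero_smul, sub_zero, Module.End.one_apply] at h
  exact (h _).add ((h _).const_mul Complex.I)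

theorem hasDerivAt_normalizedDilation_zero (lam : ℂ) (f : 𝓓'(Ω, ℂ)) (φ : 𝓓(Ω, ℝ)) :
    HasDerivAt (fun t : ℝ => normalizedDilation lam t f φ)
      ((eulerOp - lam • 1 : Module.End ℂ 𝓓'(Ω, ℂ)) f φ) 0 := by
  simpa only [normalizedDilation_zero, Module.End.one_apply] using
    hasDerivAt_normalizedDilation lam f φ 0

end Multiplication

/-! ### Powers and logarithms of the radius -/

section Punctured

open TopologicalSpace

variable {n : ℕ}

theorem norm_ne_zero_of_mem_punctured {x : EuclideanSpace ℝ (Fin n)} (hx : x ∈ punctured n) :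
    ‖x‖ ≠ 0 := norm_ne_zero_iff.2 hx

theorem rPow_mul_rPow_neg (lam : ℂ) :
    (rPow lam * rPow (-lam) : Module.End ℂ 𝓓'(punctured n, ℂ)) = 1 := by
  rw [rPow, rPow, mulOp_mul, mulOp_congr _ (contDiffOn_const (c := (1 : ℂ))), mulOp_const,
    one_smul]
  intro x hx
  have h : ((‖x‖ : ℝ) : ℂ) ≠ 0 := by exact_mod_cast norm_ne_zero_of_mem_punctured hx
  rw [← Complex.cpow_add _ _ h, add_neg_cancel, Complex.cpow_zero]

theorem logPow_eq_pow (j : ℕ) :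
    (logPow j : Module.End ℂ 𝓓'(punctured n, ℂ)) = logPow 1 ^ j := by
  induction j with
  | zero =>
    rw [pow_zero, logPow, mulOp_congr _ (contDiffOn_const (c := (1 : ℂ))), mulOp_const, one_smul]
    simp
  | succ j ih =>
    rw [pow_succ, ← ih, logPow, logPow, logPow, mulOp_mul]
    exact mulOp_congr _ _ fun x _ => by ring

theorem normalizedDilation_mul_rPow (lam : ℂ) (t : ℝ) :
    (normalizedDilation lam t * rPow lam : Module.End ℂ 𝓓'(punctured n, ℂ)) =
      rPow lam * normalizedDilation 0 t := by
  have h1 : mulOp (fun x : EuclideanSpace ℝ (Fin n) => ((‖Real.exp t • x‖ : ℝ) : ℂ) ^ lam)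
      (contDiffOn_comp_smul (contDiffOn_norm_cpow lam) (Real.exp_pos t)) =
      (Complex.exp (lam * t) • rPow lam : Module.End ℂ 𝓓'(punctured n, ℂ)) := by
    rw [← one_mul (rPow lam), ← smul_mul_assoc, ← mulOp_const _ contDiffOn_const, rPow,
      mulOp_mul]
    refine mulOp_congr _ _ fun x _ => ?_
    rw [norm_smul, Real.norm_eq_abs, Real.abs_exp, Complex.ofReal_mul,
      Complex.mul_cpow_ofReal_nonneg (Real.exp_pos t).le (norm_nonneg x), ofReal_exp_cpow]
  rw [normalizedDilation, smul_mul_assoc, rPow, dilation_mul_mulOp, h1, smul_mul_assoc, smul_smul,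
    ← Complex.exp_add, neg_add_cancel, Complex.exp_zero, one_smul, normalizedDilation]
  simp [rPow]

theorem normalizedDilation_mul_logPow_one (t : ℝ) :
    (normalizedDilation 0 t * logPow 1 : Module.End ℂ 𝓓'(punctured n, ℂ)) =
      logPow 1 * normalizedDilation 0 t + (t : ℂ) • normalizedDilation 0 t := by
  have h1 : mulOp (fun x : EuclideanSpace ℝ (Fin n) =>
        ((Real.log ‖Real.exp t • x‖ : ℝ) : ℂ) ^ 1)
      (contDiffOn_comp_smul (contDiffOn_log_norm_pow 1) (Real.exp_pos t)) =
      (logPow 1 + (t : ℂ) • 1 : Module.End ℂ 𝓓'(punctured n, ℂ)) := by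
    rw [← mulOp_const _ contDiffOn_const, logPow, ← mulOp_add]
    refine mulOp_congr _ _ fun x hx => ?_
    rw [norm_smul, Real.norm_eq_abs, Real.abs_exp, Real.log_mul (Real.exp_pos t).ne'
      (norm_ne_zero_of_mem_punctured hx), Real.log_exp]
    push_cast
    ring
  rw [normalizedDilation, smul_mul_assoc, logPow, dilation_mul_mulOp, h1, add_mul]
  simp [logPow]

/-- Multiplication by `r^lam` shifts the Euler operator by `lam`. -/
theorem eulerOp_sub_mul_rPow (lam : ℂ) :
    ((eulerOp - lam • 1) * rPow lam : Module.End ℂ 𝓓'(punctured n, ℂ)) = rPow lam * eulerOp := by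
  refine LinearMap.ext fun f => distribution_ext fun φ => ?_
  refine (hasDerivAt_normalizedDilation_zero lam (rPow lam f) φ).unique ?_
  refine (hasDerivAt_mulOp_normalizedDilation (contDiffOn_norm_cpow lam) f
    φ).congr_of_eventuallyEq (Filter.Eventually.of_forall fun t => ?_)
  exact congr($(normalizedDilation_mul_rPow lam t) f φ)

/-- The Euler operator and multiplication by `log r` satisfy the canonical commutation relation. -/
theorem eulerOp_mul_logPow_one :
    (eulerOp * logPow 1 : Module.End ℂ 𝓓'(punctured n, ℂ)) = logPow 1 * eulerOp + 1 := by
  refine LinearMap.ext fun f => distribution_ext fun φ => ?_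
  have h0 := hasDerivAt_normalizedDilation_zero 0 (logPow 1 f) φ
  have h1 := hasDerivAt_normalizedDilation_zero 0 f φ
  rw [zero_smul, sub_zero] at h0 h1
  refine h0.unique ?_
  have h2 := (hasDerivAt_mulOp_normalizedDilation (contDiffOn_log_norm_pow 1) f φ).add
    ((Complex.ofRealCLM.hasDerivAt (x := (0 : ℝ))).mul h1)
  refine (h2.congr_deriv ?_).congr_of_eventuallyEq (Filter.Eventually.of_forall fun t => ?_)
  · rw [normalizedDilation_zero]
    change _ = mulOp _ (contDiffOn_log_norm_pow 1) (eulerOp f) φ + f φ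
    simp
  · exact congr($(normalizedDilation_mul_logPow_one t) f φ)

end Punctured

/-! ### The equivalent descriptions -/

section Equivalence

open TopologicalSpace

variable {n : ℕ}

theorem isQAHD_tfae {Ω : Opens (EuclideanSpace ℝ (Fin n))} [IsCone Ω] (k : ℕ) (lam : ℂ)
    (f : 𝓓'(Ω, ℂ)) : List.TFAE [
      IsQAHD lam k f,
      ∀ (a : ℝ) (ha : 0 < a), ((dilation a ha - (a : ℂ) ^ lam • 1) ^ (k + 1)) f = 0,
      ((eulerOp - lam • 1) ^ (k + 1)) f = 0] := by
  tfae_have 1 → 2 := fun h a ha => pow_dilation_sub_eq_zero_of_isQAHD lam k f h a ha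
  tfae_have 2 → 3 := pow_eulerOp_eq_zero_of_pow_dilation_sub_eq_zero lam (k + 1) f
  tfae_have 3 → 1 := isQAHD_of_pow_eulerOp_eq_zero lam k f
  tfae_finish

theorem isHomogeneous_iff_isQAHD_zero {Ω : Opens (EuclideanSpace ℝ (Fin n))} [IsCone Ω] (lam : ℂ)
    (f : 𝓓'(Ω, ℂ)) : IsHomogeneous lam f ↔ IsQAHD lam 0 f := by
  constructor
  · intro h
    refine .intro 0 f 0 (fun r h1 h2 => by omega) fun a ha => ?_
    simpa using h a ha
  · rintro ⟨_, _, g, -, hf⟩ a ha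
    simpa using hf a ha

theorem isHomogeneous_zero_iff_eulerOp {Ω : Opens (EuclideanSpace ℝ (Fin n))} [IsCone Ω]
    (f : 𝓓'(Ω, ℂ)) : IsHomogeneous 0 f ↔ eulerOp f = 0 := by
  have h : IsQAHD 0 0 f ↔ ((eulerOp - (0 : ℂ) • 1 : Module.End ℂ 𝓓'(Ω, ℂ)) ^ (0 + 1)) f = 0 :=
    (isQAHD_tfae 0 0 f).out 0 2
  rw [isHomogeneous_iff_isQAHD_zero, h]
  simp

/-- The generalized eigenspaces of the Euler operator on the punctured space: `r^lam` conjugates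
`eulerOp` to `eulerOp - lam`, and the kernel of a power of `eulerOp` consists of polynomials in
`log r` with homogeneous coefficients. -/
theorem pow_eulerOp_eq_zero_iff_exists_logPow (k : ℕ) (lam : ℂ) (f : 𝓓'(punctured n, ℂ)) :
    ((eulerOp - lam • 1 : Module.End ℂ 𝓓'(punctured n, ℂ)) ^ (k + 1)) f = 0 ↔
      ∃ h : ℕ → 𝓓'(punctured n, ℂ), (∀ j ≤ k, IsHomogeneous 0 (h j)) ∧
        f = rPow lam (∑ j ∈ Finset.range (k + 1), logPow j (h j)) := by
  have hinv : ∀ (μ : ℂ) (u : 𝓓'(punctured n, ℂ)), rPow μ (rPow (-μ) u) = u := fun μ u =>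
    congr($(rPow_mul_rPow_neg μ) u)
  have hsemi : ∀ u : 𝓓'(punctured n, ℂ),
      ((eulerOp - lam • 1 : Module.End ℂ 𝓓'(punctured n, ℂ)) ^ (k + 1)) (rPow lam u) =
        rPow lam ((eulerOp ^ (k + 1)) u) := fun u =>
    (congr($((SemiconjBy.pow_right (a := rPow lam) (eulerOp_sub_mul_rPow lam).symm
      (k + 1)).eq) u)).symm
  have hinj : ∀ u : 𝓓'(punctured n, ℂ), rPow lam u = 0 → u = 0 := fun u hu => by
    have h := hinv (-lam) u
    rw [neg_neg, hu, map_zero] at h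
    exact h.symm
  have hlog : ∀ c : ℕ → 𝓓'(punctured n, ℂ), ∑ j ∈ Finset.range (k + 1), logPow j (c j) =
      ∑ j ∈ Finset.range (k + 1), (logPow 1 ^ j) (c j) := fun c =>
    Finset.sum_congr rfl fun j _ => by rw [logPow_eq_pow j]
  constructor
  · intro hf
    rw [← hinv lam f, hsemi] at hf
    obtain ⟨c, hc, hcu⟩ := (weyl_pow_apply_eq_zero_iff eulerOp_mul_logPow_one _ _).1 (hinj _ hf)
    refine ⟨c, fun j hj => (isHomogeneous_zero_iff_eulerOp _).2 (hc j (by omega)), ?_⟩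
    rw [hlog, ← hcu, hinv]
  · rintro ⟨c, hc, rfl⟩
    rw [hsemi, (weyl_pow_apply_eq_zero_iff eulerOp_mul_logPow_one _ _).2 ⟨c, fun j hj =>
      (isHomogeneous_zero_iff_eulerOp _).1 (hc j (by omega)), hlog c⟩, map_zero]

end Equivalence

end QuasiHomogeneous

end

theorem mainTheorem1 (n k : ℕ) (lam : ℂ) :
    (∀ f : 𝓓'(QuasiHomogeneous.punctured n, ℂ), List.TFAE [
      QuasiHomogeneous.IsQAHD lam k f,
      ∀ (a : ℝ) (ha : 0 < a),
        ((QuasiHomogeneous.dilation a ha - (a : ℂ) ^ lam • 1) ^ (k + 1)) f = 0,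
      ((QuasiHomogeneous.eulerOp - lam • 1) ^ (k + 1)) f = 0,
      ∃ h : ℕ → 𝓓'(QuasiHomogeneous.punctured n, ℂ),
        (∀ j ≤ k, QuasiHomogeneous.IsHomogeneous 0 (h j)) ∧
        f = QuasiHomogeneous.rPow lam
          (∑ j ∈ Finset.range (k + 1), QuasiHomogeneous.logPow j (h j))]) ∧
    (∀ f : 𝓓'((⊤ : TopologicalSpace.Opens (EuclideanSpace ℝ (Fin n))), ℂ), List.TFAE [
      QuasiHomogeneous.IsQAHD lam k f,
      ∀ (a : ℝ) (ha : 0 < a),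
        ((QuasiHomogeneous.dilation a ha - (a : ℂ) ^ lam • 1) ^ (k + 1)) f = 0,
      ((QuasiHomogeneous.eulerOp - lam • 1) ^ (k + 1)) f = 0]) := by
  refine ⟨fun f => ?_, QuasiHomogeneous.isQAHD_tfae k lam⟩
  tfae_have 1 ↔ 2 := (QuasiHomogeneous.isQAHD_tfae k lam f).out 0 1
  tfae_have 1 ↔ 3 := (QuasiHomogeneous.isQAHD_tfae k lam f).out 0 2
  tfae_have 3 ↔ 4 := QuasiHomogeneous.pow_eulerOp_eq_zero_iff_exists_logPow k lam f
  tfae_finish
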